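/- Let $d,k$ be non-negative integers and let $\Lambda>0$. For an open set $D\subset\mathbb{R}^d$ of finite measure and $U=(u_1,\dots,u_k)\in H^1(D;\mathbb{R}^k)$ put $\Omega_U=\{x\in D: |U(x)|>0\}=\bigcup_{i=1}^k\{u_i\neq 0\}$ and $$\mathcal{F}_\Lambda(U,D)=\sum_{i=1}^k\int_D|\nabla u_i|^2\,dx+\Lambda\,|\Omega_U| .$$ We say that $U$ is a solution of the vectorial Bernoulli problem in $D$ if $U\in H^1(D;\mathbb{R}^k)$ and $\mathcal{F}_\Lambda(U,D)\le\mathcal{F}_\Lambda(V,D)$ for every $V\in H^1(D;\mathbb{R}^k)$ with $V=U$ on $\partial D$, that is, with $v_i-u_i\in H^1_0(D)$ for $i=1,\dots,k$. Let $A=(a_{ij})$ be a real matrix with $k$ rows and $d$ columns, let $u:\mathbb{R}^d\to\mathbb{R}^k$ be the linear function $u(x)=Ax$, and put $\|A\|:=\sum_{i=1}^k\sum_{j=1}^d a_{ij}^2$. Let $B_1$ be the open unit ball of $\mathbb{R}^d$. 1. If $\|A\|\ge\Lambda$, then $u$ is a solution of the vectorial Bernoulli problem in $B_1$. 2. If $\operatorname{rank}A=1$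 and $u$ is a solution of the vectorial Bernoulli problem in $B_1$, then $\|A\|\ge\Lambda$. -/

import Mathlib

open MeasureTheory Filter Topology
open scoped Distributions Gradient

noncomputable section

namespace VectorialBernoulli

/-- `g` is a weak (distributional) gradient of `w` in the open set `D`:
`∫_D w ∂_v φ = - ∫_D (g · v) φ` for every `φ ∈ C_c^∞(D)` and every direction `v`. -/
def IsWeakGradient {d : ℕ} (D : TopologicalSpace.Opens (EuclideanSpace ℝ (Fin d)))
    (w : EuclideanSpace ℝ (Fin d) → ℝ)
    (g : EuclideanSpace ℝ (Fin d) → EuclideanSpace ℝ (Fin d)) : Prop :=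
  ∀ (φ : 𝓓(D, ℝ)) (v : EuclideanSpace ℝ (Fin d)),
    ∫ x in D, w x * fderiv ℝ φ x v = - ∫ x in D, inner ℝ (g x) v * φ x

/-- `w ∈ H¹(D)`: `w ∈ L²(D)` and `w` has a weak gradient in `L²(D)`. -/
def MemH1 {d : ℕ} (D : TopologicalSpace.Opens (EuclideanSpace ℝ (Fin d)))
    (w : EuclideanSpace ℝ (Fin d) → ℝ) : Prop :=
  MemLp w 2 (volume.restrict D) ∧
    ∃ g : EuclideanSpace ℝ (Fin d) → EuclideanSpace ℝ (Fin d),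
      MemLp g 2 (volume.restrict D) ∧ IsWeakGradient D w g

open Classical in
/-- The weak gradient of `w ∈ H¹(D)`: a chosen representative of the function in `L²(D; ℝ^d)`,
unique almost everywhere in `D`, that is a weak gradient of `w`
(and `0`, never used, if `w` is not in `H¹(D)`). -/
def weakGradient {d : ℕ} (D : TopologicalSpace.Opens (EuclideanSpace ℝ (Fin d)))
    (w : EuclideanSpace ℝ (Fin d) → ℝ) : EuclideanSpace ℝ (Fin d) → EuclideanSpace ℝ (Fin d) :=
  if h : MemH1 D w then h.2.choose else 0

/-- `w ∈ H¹₀(D)`: `w ∈ H¹(D)` is a limit in the norm of `H¹(D)` of functions in `C_c^∞(D)`. -/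
def MemH10 {d : ℕ} (D : TopologicalSpace.Opens (EuclideanSpace ℝ (Fin d)))
    (w : EuclideanSpace ℝ (Fin d) → ℝ) : Prop :=
  MemH1 D w ∧
    ∃ φ : ℕ → 𝓓(D, ℝ),
      Tendsto (fun n => eLpNorm (fun x => φ n x - w x) 2 (volume.restrict D)) atTop (𝓝 0) ∧
      Tendsto (fun n => eLpNorm (fun x => ∇ (φ n) x - weakGradient D w x) 2 (volume.restrict D))
        atTop (𝓝 0)

/-- `U = (u_1, …, u_k) ∈ H¹(D; ℝ^k)`: every component is in `H¹(D)`. -/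
def VecMemH1 {d k : ℕ} (D : TopologicalSpace.Opens (EuclideanSpace ℝ (Fin d)))
    (U : EuclideanSpace ℝ (Fin d) → EuclideanSpace ℝ (Fin k)) : Prop :=
  ∀ i, MemH1 D (fun x => U x i)

/-- The set `Ω_U = {|U| > 0} ⊆ D`. -/
def positivitySet {d k : ℕ} (D : TopologicalSpace.Opens (EuclideanSpace ℝ (Fin d)))
    (U : EuclideanSpace ℝ (Fin d) → EuclideanSpace ℝ (Fin k)) : Set (EuclideanSpace ℝ (Fin d)) :=
  {x | x ∈ D ∧ 0 < ‖U x‖}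

/-- The vectorial Bernoulli functional `∑_i ∫_D |∇u_i|² dx + Λ |Ω_U|`, for `U ∈ H¹(D; ℝ^k)` and
an open set `D` of finite measure. -/
def bernoulliEnergy {d k : ℕ} (Λ : ℝ) (D : TopologicalSpace.Opens (EuclideanSpace ℝ (Fin d)))
    (U : EuclideanSpace ℝ (Fin d) → EuclideanSpace ℝ (Fin k)) : ℝ :=
  (∑ i, (∫ x in D, ‖weakGradient D (fun y => U y i) x‖ ^ 2)) +
    Λ * volume.real (positivitySet D U)

/-- `U` solves the vectorial Bernoulli problem in `D`: it lies in `H¹(D; ℝ^k)` and minimizes the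
functional among all `V ∈ H¹(D; ℝ^k)` with the boundary values of `U` on `∂D`, that is, with
`v_i - u_i ∈ H¹₀(D)` for every `i`. -/
def IsSolution {d k : ℕ} (Λ : ℝ) (D : TopologicalSpace.Opens (EuclideanSpace ℝ (Fin d)))
    (U : EuclideanSpace ℝ (Fin d) → EuclideanSpace ℝ (Fin k)) : Prop :=
  VecMemH1 D U ∧
    ∀ V : EuclideanSpace ℝ (Fin d) → EuclideanSpace ℝ (Fin k),
      VecMemH1 D V → (∀ i, MemH10 D (fun x => V x i - U x i)) →
        bernoulliEnergy Λ D U ≤ bernoulliEnergy Λ D V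

/-- The open unit ball `B_1` of `ℝ^d`. -/
def unitBall (d : ℕ) : TopologicalSpace.Opens (EuclideanSpace ℝ (Fin d)) :=
  ⟨Metric.ball 0 1, Metric.isOpen_ball⟩

/-- The linear map `x ↦ A x` from `ℝ^d` to `ℝ^k`. -/
def linearMap {d k : ℕ} (A : Matrix (Fin k) (Fin d) ℝ) (x : EuclideanSpace ℝ (Fin d)) :
    EuclideanSpace ℝ (Fin k) :=
  WithLp.toLp 2 (A.mulVec x.ofLp)

end VectorialBernoulli

end

/-!
Throughout, `B` is the unit ball and `‖A‖ = ∑ᵢⱼ aᵢⱼ²`.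

**Large slope implies minimality.** Let `v` be a component of a competitor, `ℓ = ⟪a, ·⟫` the
corresponding component of the linear map, so that `v - ℓ ∈ H¹₀(B)`. Since `∇v = 0` a.e. on
`{v = 0}` and `∫ ⟪∇v, a⟫ = ‖a‖² |B|`, expanding `0 ≤ ∫ ‖∇v - 1_{v ≠ 0} a‖²` gives
`∫ ‖∇v‖² ≥ ‖a‖² (2 |B| - |{v ≠ 0}|)`. Summing over the components bounds the energy of the
competitor `V` below by `‖A‖ (2 |B| - |Ω_V|) + Λ |Ω_V|`, which is decreasing in `|Ω_V| ≤ |B|` when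
`‖A‖ ≥ Λ` and equals the energy of the linear map at `|Ω_V| = |B|`. The Sobolev fact on `{v = 0}` is
not needed as such: in `le_integral_norm_add_gradient_sq` the indicator function is replaced by a
continuous `s` and `v` by `ℓ + φ` with `φ` a test function, where the primitive `F` of `s` makes
`F (ℓ + φ) - F ℓ` a compactly supported function. Both replacements are then removed by passing to
the limit (`le_integral_norm_weakGradient_sq`).

**Small slope and rank one exclude minimality.** A matrix of rank one acts as `x ↦ ⟪e, x⟫ c` with
`‖e‖ = 1` and `‖c‖² = ‖A‖`. For a test function `φ` the competitor `(⟪e, ·⟫ + φ) c` changes the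
Dirichlet energy by `‖A‖ ∫ ‖∇φ‖²` and lowers the volume term by `Λ |{⟪e, ·⟫ + φ = 0}|`. If
`‖A‖ < Λ`, a thin slab `{|⟪e, x⟫| < δ}` can be opened at a Dirichlet cost per unit of volume
arbitrarily close to one (`exists_testFunction_gradient_lt`), which makes the total negative. Outside
the slab the perturbation has size `δ` and only has to be cut off at distance of order one, and this
costs `O(δ²)`, whereas the volume of the slab is of order `δ`.
-/

open MeasureTheory Filter Topology
open scoped Distributions Gradient

namespace VectorialBernoulli

local notation "𝔼" d:max => EuclideanSpace ℝ (Fin d)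

/-! ### Weak gradients -/

theorem integral_fderiv_apply_eq_zero {d : ℕ} {h : 𝔼 d → ℝ} (hh : ContDiff ℝ 1 h)
    (hc : HasCompactSupport h) (v : 𝔼 d) : ∫ x, fderiv ℝ h x v = 0 := by
  have hi : Integrable (fun x => fderiv ℝ h x v) :=
    ((hh.continuous_fderiv one_ne_zero).clm_apply continuous_const).integrable_of_hasCompactSupport
      (hc.fderiv_apply (𝕜 := ℝ) v)
  have := integral_mul_fderiv_eq_neg_fderiv_mul_of_integrable (μ := (volume : Measure (𝔼 d)))
    (f := fun _ : 𝔼 d => (1 : ℝ)) (g := h) (v := v) (by simp) (by simpa using hi)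
    (by simpa using hh.continuous.integrable_of_hasCompactSupport hc)
    (fun x _ => by fun_prop) (fun x _ => hh.differentiable one_ne_zero x)
  simpa using this

theorem continuous_gradient {d : ℕ} {w : 𝔼 d → ℝ} (hw : ContDiff ℝ 1 w) : Continuous (∇ w) :=
  (InnerProductSpace.toDual ℝ (𝔼 d)).symm.continuous.comp (hw.continuous_fderiv one_ne_zero)

theorem isWeakGradient_gradient {d : ℕ} (D : TopologicalSpace.Opens (𝔼 d)) {w : 𝔼 d → ℝ}
    (hw : ContDiff ℝ 1 w) : IsWeakGradient D w (∇ w) := by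
  intro φ v
  have hφ : ContDiff ℝ 1 φ := φ.contDiff.of_le (by simp)
  have hsub := φ.tsupport_subset
  have hdφ := (hφ.continuous_fderiv one_ne_zero).clm_apply (continuous_const (y := v))
  have hdw := (hw.continuous_fderiv one_ne_zero).clm_apply (continuous_const (y := v))
  have hcφ := φ.hasCompactSupport
  have hcφ' := φ.hasCompactSupport.fderiv_apply (𝕜 := ℝ) v
  rw [setIntegral_eq_integral_of_forall_compl_eq_zero, setIntegral_eq_integral_of_forall_compl_eq_zero]
  · simp_rw [inner_gradient_left]
    exact integral_mul_fderiv_eq_neg_fderiv_mul_of_integrable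
      ((hdw.mul φ.continuous).integrable_of_hasCompactSupport hcφ.mul_left)
      ((hw.continuous.mul hdφ).integrable_of_hasCompactSupport hcφ'.mul_left)
      ((hw.continuous.mul φ.continuous).integrable_of_hasCompactSupport hcφ.mul_left)
      (fun x _ => hw.differentiable one_ne_zero x) (fun x _ => hφ.differentiable one_ne_zero x)
  · intro x hx
    rw [image_eq_zero_of_notMem_tsupport (fun h => hx (hsub h)), mul_zero]
  · intro x hx
    rw [fderiv_of_notMem_tsupport (𝕜 := ℝ) (fun h => hx (hsub h))]
    simp

/-- Uniqueness of the weak gradient: the fundamental lemma of the calculus of variations. -/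
theorem IsWeakGradient.ae_eq {d : ℕ} {D : TopologicalSpace.Opens (𝔼 d)} {w : 𝔼 d → ℝ}
    {g₁ g₂ : 𝔼 d → 𝔼 d} (h₁ : IsWeakGradient D w g₁) (h₂ : IsWeakGradient D w g₂)
    (hg₁ : MemLp g₁ 2 (volume.restrict D)) (hg₂ : MemLp g₂ 2 (volume.restrict D)) :
    g₁ =ᵐ[volume.restrict D] g₂ := by
  have hloc : ∀ {g : 𝔼 d → 𝔼 d}, MemLp g 2 (volume.restrict D) →
      LocallyIntegrableOn g D volume := by
    intro g hg
    refine (locallyIntegrableOn_iff D.isOpen.isLocallyClosed).2 fun K hK hKc => ?_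
    have : IsFiniteMeasure (volume.restrict K) := ⟨by simpa using hKc.measure_lt_top⟩
    exact (hg.mono_measure (Measure.restrict_mono hK le_rfl)).integrable one_le_two
  have hint : ∀ {g : 𝔼 d → 𝔼 d}, MemLp g 2 (volume.restrict D) → ∀ (φ : 𝓓(D, ℝ)) (v : 𝔼 d),
      Integrable (fun x => inner ℝ (g x) v * φ x) (volume.restrict D) := by
    intro g hg φ v
    have hφ : MemLp φ 2 (volume.restrict D) :=
      φ.continuous.memLp_of_hasCompactSupport φ.hasCompactSupport
    have h1 : MemLp (fun x => inner ℝ (g x) v) 2 (volume.restrict D) := by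
      simpa [real_inner_comm] using hg.const_inner (𝕜 := ℝ) v
    exact h1.integrable_mul hφ
  have key : ∀ i, ∀ᵐ x, x ∈ D → (g₁ x - g₂ x) i = 0 := by
    intro i
    have := D.isOpen.ae_eq_zero_of_integral_contDiff_smul_eq_zero
      (f := fun x => inner ℝ (g₁ x - g₂ x) (EuclideanSpace.single i (1 : ℝ))) (μ := volume) ?_ ?_
    · simpa [EuclideanSpace.inner_single_right] using this
    · have h3 := (hloc hg₁).sub (hloc hg₂)
      refine (locallyIntegrableOn_iff D.isOpen.isLocallyClosed).2 fun K hK hKc => ?_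
      have h4 := h3.integrableOn_compact_subset hK hKc
      exact h4.inner_const (𝕜 := ℝ) _
    · intro φ hφ hφc hφD
      let ψ : 𝓓(D, ℝ) := ⟨φ, hφ, hφc, hφD⟩
      have e1 := h₁ ψ (EuclideanSpace.single i (1 : ℝ))
      have e2 := h₂ ψ (EuclideanSpace.single i (1 : ℝ))
      have e3 := integral_sub (hint hg₁ ψ (EuclideanSpace.single i (1 : ℝ)))
        (hint hg₂ ψ (EuclideanSpace.single i (1 : ℝ)))
      rw [← setIntegral_eq_integral_of_forall_compl_eq_zero (s := D)]
      · have e4 : ∫ x in D, φ x • inner ℝ (g₁ x - g₂ x) (EuclideanSpace.single i (1 : ℝ)) =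
            ∫ x in D, (inner ℝ (g₁ x) (EuclideanSpace.single i (1 : ℝ)) * ψ x -
              inner ℝ (g₂ x) (EuclideanSpace.single i (1 : ℝ)) * ψ x) := by
          refine integral_congr_ae (.of_forall fun x => ?_)
          change φ x * _ = _ * φ x - _ * φ x
          rw [inner_sub_left]; ring
        rw [e4, e3]; linarith
      · intro x hx
        rw [image_eq_zero_of_notMem_tsupport (fun h => hx (hφD h)), zero_smul]
  refine (ae_restrict_iff' D.isOpen.measurableSet).2 ?_
  filter_upwards [ae_all_iff.2 key] with x hx hxD
  ext i
  simpa [sub_eq_zero] using hx i hxD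

theorem memLp_weakGradient {d : ℕ} {D : TopologicalSpace.Opens (𝔼 d)} {w : 𝔼 d → ℝ}
    (h : MemH1 D w) : MemLp (weakGradient D w) 2 (volume.restrict D) := by
  rw [weakGradient, dif_pos h]; exact h.2.choose_spec.1

theorem isWeakGradient_weakGradient {d : ℕ} {D : TopologicalSpace.Opens (𝔼 d)} {w : 𝔼 d → ℝ}
    (h : MemH1 D w) : IsWeakGradient D w (weakGradient D w) := by
  rw [weakGradient, dif_pos h]; exact h.2.choose_spec.2

theorem IsWeakGradient.weakGradient_ae_eq {d : ℕ} {D : TopologicalSpace.Opens (𝔼 d)}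
    {w : 𝔼 d → ℝ} {g : 𝔼 d → 𝔼 d} (h : IsWeakGradient D w g) (hw : MemH1 D w)
    (hg : MemLp g 2 (volume.restrict D)) : weakGradient D w =ᵐ[volume.restrict D] g :=
  (isWeakGradient_weakGradient hw).ae_eq h (memLp_weakGradient hw) hg

theorem IsWeakGradient.add {d : ℕ} {D : TopologicalSpace.Opens (𝔼 d)} {w₁ w₂ : 𝔼 d → ℝ}
    {g₁ g₂ : 𝔼 d → 𝔼 d} (h₁ : IsWeakGradient D w₁ g₁) (h₂ : IsWeakGradient D w₂ g₂)
    (hw₁ : MemLp w₁ 2 (volume.restrict D)) (hw₂ : MemLp w₂ 2 (volume.restrict D))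
    (hg₁ : MemLp g₁ 2 (volume.restrict D)) (hg₂ : MemLp g₂ 2 (volume.restrict D)) :
    IsWeakGradient D (fun x => w₁ x + w₂ x) (fun x => g₁ x + g₂ x) := by
  intro φ v
  have hφ : MemLp φ 2 (volume.restrict D) :=
    φ.continuous.memLp_of_hasCompactSupport φ.hasCompactSupport
  have hφ' : MemLp (fun x => fderiv ℝ φ x v) 2 (volume.restrict D) :=
    ((φ.contDiff.continuous_fderiv (by simp)).clm_apply
      continuous_const).memLp_of_hasCompactSupport (φ.hasCompactSupport.fderiv_apply (𝕜 := ℝ) v)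
  have hin : ∀ {g : 𝔼 d → 𝔼 d}, MemLp g 2 (volume.restrict D) →
      MemLp (fun x => inner ℝ (g x) v) 2 (volume.restrict D) := fun hg => by
    simpa [real_inner_comm] using hg.const_inner (𝕜 := ℝ) v
  simp_rw [inner_add_left, add_mul]
  have e₁ := integral_add (hw₁.integrable_mul hφ') (hw₂.integrable_mul hφ')
  have e₂ := integral_add ((hin hg₁).integrable_mul hφ) ((hin hg₂).integrable_mul hφ)
  simp only [Pi.mul_apply] at e₁ e₂
  rw [e₁, e₂, h₁ φ v, h₂ φ v]
  ring

theorem memLp_two_restrict_unitBall {d : ℕ} {F : Type*} [NormedAddCommGroup F]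
    [SecondCountableTopology F] {f : 𝔼 d → F} (hf : Continuous f) :
    MemLp f 2 (volume.restrict (unitBall d)) := by
  have hK : IsCompact (Metric.closedBall (0 : 𝔼 d) 1) := isCompact_closedBall 0 1
  obtain ⟨C, hC⟩ := hK.exists_bound_of_continuousOn hf.continuousOn
  have : IsFiniteMeasure (volume.restrict (unitBall d : Set (𝔼 d))) :=
    ⟨by simpa [unitBall] using measure_ball_lt_top⟩
  refine .of_bound hf.aestronglyMeasurable C ?_
  refine (ae_restrict_iff' (unitBall d).isOpen.measurableSet).2 (.of_forall fun x hx => hC x ?_)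
  exact Metric.ball_subset_closedBall hx

theorem memH1_unitBall_of_contDiff {d : ℕ} {w : 𝔼 d → ℝ} (hw : ContDiff ℝ 1 w) :
    MemH1 (unitBall d) w :=
  ⟨memLp_two_restrict_unitBall hw.continuous, ∇ w,
    memLp_two_restrict_unitBall (continuous_gradient hw), isWeakGradient_gradient _ hw⟩

theorem weakGradient_unitBall_of_contDiff {d : ℕ} {w : 𝔼 d → ℝ} (hw : ContDiff ℝ 1 w) :
    weakGradient (unitBall d) w =ᵐ[volume.restrict (unitBall d)] ∇ w :=
  (isWeakGradient_gradient _ hw).weakGradient_ae_eq (memH1_unitBall_of_contDiff hw)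
    (memLp_two_restrict_unitBall (continuous_gradient hw))

/-! ### The Dirichlet energy of functions with linear boundary values -/

theorem tendsto_integral_norm_sq {X F : Type*} [MeasurableSpace X] {μ : Measure X}
    [NormedAddCommGroup F] {f : ℕ → X → F} {g : X → F} (hf : ∀ n, MemLp (f n) 2 μ)
    (hg : MemLp g 2 μ) (h : Tendsto (fun n => eLpNorm (fun x => f n x - g x) 2 μ) atTop (𝓝 0)) :
    Tendsto (fun n => ∫ x, ‖f n x‖ ^ 2 ∂μ) atTop (𝓝 (∫ x, ‖g x‖ ^ 2 ∂μ)) := by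
  have hsq : ∀ {f : X → F} (hf : MemLp f 2 μ), ∫ x, ‖f x‖ ^ 2 ∂μ = ‖hf.toLp f‖ ^ 2 := by
    intro f hf
    have h0 : 0 ≤ ∫ x, ‖f x‖ ^ 2 ∂μ := integral_nonneg fun x => by positivity
    rw [Lp.norm_toLp, hf.eLpNorm_eq_integral_rpow_norm two_ne_zero ENNReal.ofNat_ne_top,
      ENNReal.toReal_ofReal (by positivity)]
    simp only [ENNReal.toReal_ofNat, Real.rpow_ofNat]
    rw [← Real.rpow_natCast, ← Real.rpow_mul h0]
    norm_num
  simp_rw [fun n => hsq (hf n), hsq hg]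
  exact (((Lp.tendsto_Lp_iff_tendsto_eLpNorm'' f hf g hg).2 h).norm).pow 2

theorem measurableSet_unitBall {d : ℕ} : MeasurableSet (unitBall d : Set (𝔼 d)) :=
  (unitBall d).isOpen.measurableSet

instance isFiniteMeasure_restrict_unitBall {d : ℕ} :
    IsFiniteMeasure (volume.restrict (unitBall d : Set (𝔼 d))) :=
  ⟨by simpa [unitBall] using measure_ball_lt_top⟩

theorem contDiff_inner_left {d : ℕ} (a : 𝔼 d) : ContDiff ℝ 1 (fun x : 𝔼 d => inner ℝ a x) :=
  (innerSL ℝ a).contDiff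

theorem gradient_inner_left {d : ℕ} (a : 𝔼 d) :
    ∇ (fun x : 𝔼 d => inner ℝ a x) = fun _ => a := by
  refine gradient_eq fun x => ?_
  rw [hasGradientAt_iff_hasFDerivAt]
  exact (innerSL ℝ a).hasFDerivAt

/-- If `F` is a primitive of `s` and `ℓ = ⟪a, ·⟫`, then `F (ℓ + φ) - F ℓ` has compact support in
the ball, so its derivative in the direction `a` has integral zero. -/
theorem integral_comp_inner_add_testFunction {d : ℕ} {s : ℝ → ℝ} (hs : Continuous s) (a : 𝔼 d)
    (φ : 𝓓(unitBall d, ℝ)) :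
    ∫ x in unitBall d, s (inner ℝ a x + φ x) * inner ℝ (a + ∇ φ x) a =
      ∫ x in unitBall d, s (inner ℝ a x) * ‖a‖ ^ 2 := by
  have hφ : ContDiff ℝ 1 φ := φ.contDiff.of_le (by simp)
  have hgφ := continuous_gradient hφ
  set F : ℝ → ℝ := fun t => ∫ r in (0 : ℝ)..t, s r
  have hF : ∀ t, HasDerivAt F (s t) t := fun t =>
    intervalIntegral.integral_hasDerivAt_right (hs.intervalIntegrable _ _)
      (hs.stronglyMeasurableAtFilter _ _) hs.continuousAt
  have hF1 : ContDiff ℝ 1 F := contDiff_one_iff_deriv.2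
    ⟨fun t => (hF t).differentiableAt, by
      rw [show deriv F = s from funext fun t => (hF t).deriv]; exact hs⟩
  have hℓ := contDiff_inner_left a
  set h : 𝔼 d → ℝ := fun x => F (inner ℝ a x + φ x) - F (inner ℝ a x)
  have hh : ContDiff ℝ 1 h := (hF1.comp (hℓ.add hφ)).sub (hF1.comp hℓ)
  have hzero : ∀ x, φ x = 0 → h x = 0 := fun x hx => by simp [h, hx]
  have hcs : HasCompactSupport h :=
    φ.hasCompactSupport.mono fun x hx hx' => hx (hzero x hx')
  have hts : tsupport h ⊆ unitBall d :=
    (closure_mono fun x (hx : h x ≠ 0) (hx' : φ x = 0) => hx (hzero x hx')).trans φ.tsupport_subset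
  have hd : ∀ x, fderiv ℝ h x a =
      s (inner ℝ a x + φ x) * inner ℝ (a + ∇ φ x) a - s (inner ℝ a x) * ‖a‖ ^ 2 := by
    intro x
    have h1 : HasFDerivAt (fun x : 𝔼 d => inner ℝ a x) (innerSL ℝ a) x :=
      (innerSL ℝ a).hasFDerivAt
    have h2 := h1.add (hφ.differentiable one_ne_zero x).hasFDerivAt
    have h3 := ((hF _).comp_hasFDerivAt x h2).sub ((hF _).comp_hasFDerivAt x h1)
    have h4 : HasFDerivAt h _ x := h3
    rw [h4.fderiv]
    simp [inner_add_left, inner_gradient_left, mul_add]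
  have h0 : ∫ x in unitBall d, fderiv ℝ h x a = 0 := by
    rw [setIntegral_eq_integral_of_forall_compl_eq_zero,
      integral_fderiv_apply_eq_zero hh hcs]
    intro x hx
    rw [fderiv_of_notMem_tsupport (𝕜 := ℝ) (fun h => hx (hts h))]
    simp
  simp_rw [hd] at h0
  have hi1 : Integrable (fun x => s (inner ℝ a x + φ x) * inner ℝ (a + ∇ φ x) a)
      (volume.restrict (unitBall d : Set (𝔼 d))) :=
    (memLp_two_restrict_unitBall (by fun_prop)).integrable one_le_two
  have hi2 : Integrable (fun x => s (inner ℝ a x) * ‖a‖ ^ 2) (volume.restrict (unitBall d : Set (𝔼 d))) :=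
    (memLp_two_restrict_unitBall (by fun_prop)).integrable one_le_two
  rw [integral_sub hi1 hi2] at h0
  linarith

/-- This is `0 ≤ ∫ ‖a + ∇φ - s (ℓ + φ) a‖²`, expanded. -/
theorem le_integral_norm_add_gradient_sq {d : ℕ} {s : ℝ → ℝ} (hs : Continuous s) (a : 𝔼 d)
    (φ : 𝓓(unitBall d, ℝ)) :
    2 * ∫ x in unitBall d, s (inner ℝ a x) * ‖a‖ ^ 2 ≤
      (∫ x in unitBall d, ‖a + ∇ φ x‖ ^ 2) +
        ‖a‖ ^ 2 * ∫ x in unitBall d, ‖s (inner ℝ a x + φ x)‖ ^ 2 := by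
  have hφ : ContDiff ℝ 1 φ := φ.contDiff.of_le (by simp)
  have hgφ := continuous_gradient hφ
  have hφc := φ.continuous
  have hint : ∀ {f : 𝔼 d → ℝ}, Continuous f → Integrable f (volume.restrict (unitBall d : Set (𝔼 d))) :=
    fun hf => (memLp_two_restrict_unitBall hf).integrable one_le_two
  rw [← integral_comp_inner_add_testFunction hs a φ, ← integral_const_mul, ← integral_const_mul,
    ← integral_add (hint (by fun_prop)) (hint (by fun_prop))]
  refine integral_mono (hint (by fun_prop)) (hint (by fun_prop)) fun x => ?_
  have h0 := sq_nonneg ‖(a + ∇ φ x) - s (inner ℝ a x + φ x) • a‖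
  rw [norm_sub_sq_real, norm_smul, mul_pow, inner_smul_right] at h0
  dsimp only
  linarith

theorem volume_setOf_inner_eq_zero {d : ℕ} {a : 𝔼 d} (ha : a ≠ 0) :
    volume {x : 𝔼 d | inner ℝ a x = 0} = 0 := by
  have := Measure.addHaar_submodule (volume : Measure (𝔼 d)) (LinearMap.ker (innerSL ℝ a).toLinearMap)
    (fun h => ha (by
      have : a ∈ LinearMap.ker (innerSL ℝ a).toLinearMap := h ▸ Submodule.mem_top
      simpa using this))
  exact this

/-- The ramp `t ↦ min (m |t|) 1` increases to the indicator function of `{t ≠ 0}` as `m → ∞`. -/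
def ramp (m : ℕ) (t : ℝ) : ℝ := min (m * |t|) 1

theorem continuous_ramp (m : ℕ) : Continuous (ramp m) := by unfold ramp; fun_prop

theorem ramp_nonneg (m : ℕ) (t : ℝ) : 0 ≤ ramp m t := le_min (by positivity) zero_le_one

theorem ramp_le_one (m : ℕ) (t : ℝ) : ramp m t ≤ 1 := min_le_right _ _

theorem ramp_zero (m : ℕ) : ramp m 0 = 0 := by simp [ramp]

theorem abs_ramp_sub_ramp_le (m : ℕ) (x y : ℝ) : |ramp m x - ramp m y| ≤ m * |x - y| := by
  have h := abs_min_sub_min_le_max ((m : ℝ) * |x|) 1 (m * |y|) 1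
  have h2 : abs ((m : ℝ) * |x| - m * |y|) ≤ m * |x - y| := by
    rw [← mul_sub, abs_mul, Nat.abs_cast]
    exact mul_le_mul_of_nonneg_left (abs_abs_sub_abs_le_abs_sub x y) (Nat.cast_nonneg m)
  refine h.trans (max_le h2 ?_)
  simp; positivity

theorem tendsto_ramp {t : ℝ} (ht : t ≠ 0) : Tendsto (fun m => ramp m t) atTop (𝓝 1) := by
  refine tendsto_const_nhds.congr' ?_
  obtain ⟨N, hN⟩ := exists_nat_ge (1 / |t|)
  filter_upwards [eventually_ge_atTop N] with m hm
  have : (1 : ℝ) ≤ m * |t| := by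
    rw [← div_le_iff₀ (abs_pos.2 ht)]
    exact hN.trans (by exact_mod_cast hm)
  exact (min_eq_right this).symm

/-- Passing to the limit in `le_integral_norm_add_gradient_sq` needs only the convergence of two
`L²` norms; the vanishing of `∇v` on `{v = 0}` is never used. -/
theorem le_integral_norm_weakGradient_sq {d : ℕ} (a : 𝔼 d) {v : 𝔼 d → ℝ}
    (hv : MemH1 (unitBall d) v) (hw : MemH10 (unitBall d) (fun x => v x - inner ℝ a x)) :
    ‖a‖ ^ 2 * (2 * volume.real (unitBall d : Set (𝔼 d)) -
        volume.real {x | x ∈ unitBall d ∧ v x ≠ 0}) ≤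
      ∫ x in unitBall d, ‖weakGradient (unitBall d) v x‖ ^ 2 := by
  set μ : Measure (𝔼 d) := volume.restrict (unitBall d)
  obtain ⟨hw1, φ, hφ0, hφ1⟩ := hw
  set G := weakGradient (unitBall d) (fun x => v x - inner ℝ a x)
  have hφC : ∀ n, ContDiff ℝ 1 (φ n) := fun n => (φ n).contDiff.of_le (by simp)
  have hℓ := contDiff_inner_left a
  have hℓg := gradient_inner_left a
  have hGv : weakGradient (unitBall d) v =ᵐ[μ] fun x => G x + a := by
    have h1 := (isWeakGradient_weakGradient hw1).add (isWeakGradient_gradient (unitBall d) hℓ)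
      hw1.1 (memLp_two_restrict_unitBall hℓ.continuous) (memLp_weakGradient hw1)
      (memLp_two_restrict_unitBall (continuous_gradient hℓ))
    simp only [sub_add_cancel, hℓg] at h1
    exact h1.weakGradient_ae_eq hv
      ((memLp_weakGradient hw1).add (memLp_two_restrict_unitBall continuous_const))
  have hlim1 : Tendsto (fun n => ∫ x in unitBall d, ‖a + ∇ (φ n) x‖ ^ 2) atTop
      (𝓝 (∫ x in unitBall d, ‖weakGradient (unitBall d) v x‖ ^ 2)) := by
    refine tendsto_integral_norm_sq (fun n => memLp_two_restrict_unitBall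
      (continuous_const.add (continuous_gradient (hφC n)))) (memLp_weakGradient hv) ?_
    refine hφ1.congr fun n => eLpNorm_congr_ae ?_
    filter_upwards [hGv] with x hx
    rw [hx]; abel
  set Z : Set (𝔼 d) := {x | v x ≠ 0}
  have hset : {x | x ∈ unitBall d ∧ v x ≠ 0} = Z ∩ (unitBall d : Set (𝔼 d)) := by
    ext x; exact and_comm
  have hZ : NullMeasurableSet Z μ :=
    (hv.1.aestronglyMeasurable.nullMeasurableSet_eq_fun aestronglyMeasurable_const).compl
  have hvol : volume.real {x | x ∈ unitBall d ∧ v x ≠ 0} = μ.real Z := by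
    rw [hset, measureReal_def, measureReal_def, Measure.restrict_apply₀ hZ]
  have hbound : ∀ {f : 𝔼 d → ℝ} (m : ℕ), AEStronglyMeasurable f μ →
      MemLp (fun x => ramp m (f x)) 2 μ := fun m hf =>
    .of_bound ((continuous_ramp m).comp_aestronglyMeasurable hf) 1 (.of_forall fun x => by
      rw [Real.norm_of_nonneg (ramp_nonneg _ _)]; exact ramp_le_one _ _)
  have hm : ∀ m : ℕ, 2 * ∫ x in unitBall d, ramp m (inner ℝ a x) * ‖a‖ ^ 2 ≤
      (∫ x in unitBall d, ‖weakGradient (unitBall d) v x‖ ^ 2) + ‖a‖ ^ 2 * μ.real Z := by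
    intro m
    have hlim2 : Tendsto (fun n => ∫ x in unitBall d, ‖ramp m (inner ℝ a x + φ n x)‖ ^ 2) atTop
        (𝓝 (∫ x in unitBall d, ‖ramp m (v x)‖ ^ 2)) := by
      refine tendsto_integral_norm_sq
        (fun n => hbound m (hℓ.continuous.add (φ n).continuous).aestronglyMeasurable)
        (hbound m hv.1.aestronglyMeasurable) ?_
      have h3 := ENNReal.Tendsto.const_mul (a := ENNReal.ofReal m) hφ0
        (.inr ENNReal.ofReal_ne_top)
      rw [mul_zero] at h3
      refine tendsto_of_tendsto_of_tendsto_of_le_of_le tendsto_const_nhds h3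
        (fun n => zero_le) fun n => ?_
      refine eLpNorm_le_mul_eLpNorm_of_ae_le_mul (.of_forall fun x => ?_) 2
      refine (abs_ramp_sub_ramp_le m _ _).trans_eq ?_
      rw [Real.norm_eq_abs]; congr 2; ring
    have h4 := ge_of_tendsto' (hlim1.add (hlim2.const_mul (‖a‖ ^ 2)))
      fun n => le_integral_norm_add_gradient_sq (continuous_ramp m) a (φ n)
    refine h4.trans (add_le_add_right (mul_le_mul_of_nonneg_left ?_ (sq_nonneg _)) _)
    have hone : ∫ x, Z.indicator (fun _ => (1 : ℝ)) x ∂μ = μ.real Z := by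
      rw [integral_indicator₀ hZ]; simp
    rw [← hone]
    refine integral_mono_of_nonneg (.of_forall fun x => by positivity)
      ((integrable_const 1).indicator₀ hZ) (.of_forall fun x => ?_)
    by_cases hx : v x = 0
    · simp [hx, ramp_zero, Z]
    · have : x ∈ Z := hx
      rw [Set.indicator_of_mem this]
      dsimp only
      rw [Real.norm_of_nonneg (ramp_nonneg _ _)]
      exact pow_le_one₀ (ramp_nonneg _ _) (ramp_le_one _ _)
  rcases eq_or_ne a 0 with ha | ha
  · rw [ha, norm_zero, zero_pow two_ne_zero, zero_mul]
    exact integral_nonneg fun x => sq_nonneg _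
  have hlim3 : Tendsto (fun m : ℕ => ∫ x in unitBall d, ramp m (inner ℝ a x) * ‖a‖ ^ 2) atTop
      (𝓝 (∫ _, 1 * ‖a‖ ^ 2 ∂μ)) := by
    refine tendsto_integral_of_dominated_convergence (μ := μ) (fun _ => ‖a‖ ^ 2)
      (fun m => (((continuous_ramp m).comp hℓ.continuous).mul
        continuous_const).aestronglyMeasurable) (integrable_const _)
      (fun m => .of_forall fun x => ?_) ?_
    · rw [norm_mul, Real.norm_of_nonneg (ramp_nonneg _ _), Real.norm_of_nonneg (sq_nonneg _)]
      exact mul_le_of_le_one_left (sq_nonneg _) (ramp_le_one _ _)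
    · have h5 : ∀ᵐ x : 𝔼 d, inner ℝ a x ≠ 0 := by
        rw [ae_iff]; simpa using volume_setOf_inner_eq_zero ha
      filter_upwards [ae_restrict_of_ae h5] with x hx
      exact (tendsto_ramp hx).mul tendsto_const_nhds
  have h6 := le_of_tendsto' (hlim3.const_mul 2) hm
  rw [hvol]
  simp only [one_mul, integral_const, smul_eq_mul] at h6
  rw [show μ.real Set.univ = volume.real (unitBall d : Set (𝔼 d)) from
    measureReal_restrict_apply_univ _] at h6
  linarith

theorem linearMap_apply {d k : ℕ} (A : Matrix (Fin k) (Fin d) ℝ) (x : 𝔼 d) (i : Fin k) :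
    linearMap A x i = inner ℝ (WithLp.toLp 2 (A i)) x := by
  simp [linearMap, Matrix.mulVec, dotProduct, PiLp.inner_apply, mul_comm]

theorem contDiff_linearMap {d k : ℕ} (A : Matrix (Fin k) (Fin d) ℝ) (i : Fin k) :
    ContDiff ℝ 1 (fun x => linearMap A x i) := by
  simp_rw [linearMap_apply]; exact contDiff_inner_left _

theorem norm_row_sq {d k : ℕ} (A : Matrix (Fin k) (Fin d) ℝ) (i : Fin k) :
    ‖(WithLp.toLp 2 (A i) : 𝔼 d)‖ ^ 2 = ∑ j, A i j ^ 2 := by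
  simp [EuclideanSpace.norm_sq_eq]

theorem integral_norm_weakGradient_linearMap_sq {d k : ℕ} (A : Matrix (Fin k) (Fin d) ℝ)
    (i : Fin k) :
    ∫ x in unitBall d, ‖weakGradient (unitBall d) (fun y => linearMap A y i) x‖ ^ 2 =
      (∑ j, A i j ^ 2) * volume.real (unitBall d : Set (𝔼 d)) := by
  have hg : ∇ (fun y => linearMap A y i) = fun _ => WithLp.toLp 2 (A i) := by
    simp_rw [linearMap_apply]
    exact gradient_inner_left _
  rw [integral_congr_ae (g := fun _ => ∑ j, A i j ^ 2)]
  · simp [mul_comm]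
  · filter_upwards [weakGradient_unitBall_of_contDiff (contDiff_linearMap A i)] with x hx
    rw [hx, hg, norm_row_sq]

/-- The Dirichlet energy of `V` is at least `‖A‖ (2 |B₁| - |Ω_V|)`, and `|Ω_V| ≤ |B₁|`. -/
theorem isSolution_linearMap_of_le {d k : ℕ} {Λ : ℝ} (hΛ : 0 < Λ) {A : Matrix (Fin k) (Fin d) ℝ}
    (hA : Λ ≤ ∑ i, ∑ j, A i j ^ 2) : IsSolution Λ (unitBall d) (linearMap A) := by
  refine ⟨fun i => memH1_unitBall_of_contDiff (contDiff_linearMap A i), fun V hV hVA => ?_⟩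
  have hfin : volume (unitBall d : Set (𝔼 d)) ≠ ⊤ := measure_ball_lt_top.ne
  set b := volume.real (unitBall d : Set (𝔼 d))
  set m := volume.real (positivitySet (unitBall d) V)
  have hmono : ∀ {s : Set (𝔼 d)}, s ⊆ unitBall d → volume.real s ≤ b := fun hs =>
    measureReal_mono hs hfin
  have hmb : m ≤ b := hmono fun x hx => hx.1
  have hu : volume.real (positivitySet (unitBall d) (linearMap A)) ≤ b := hmono fun x hx => hx.1
  have hi : ∀ i, (∑ j, A i j ^ 2) * (2 * b - m) ≤
      ∫ x in unitBall d, ‖weakGradient (unitBall d) (fun y => V y i) x‖ ^ 2 := by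
    intro i
    have h1 := hVA i
    simp_rw [linearMap_apply] at h1
    have h2 := le_integral_norm_weakGradient_sq _ (hV i) h1
    rw [norm_row_sq] at h2
    refine le_trans (mul_le_mul_of_nonneg_left ?_ (Finset.sum_nonneg fun j _ => sq_nonneg _)) h2
    refine sub_le_sub_left ?_ _
    refine measureReal_mono (fun x hx => ?_)
      (measure_ne_top_of_subset (fun x (hx : x ∈ positivitySet _ V) => hx.1) hfin)
    refine ⟨hx.1, norm_pos_iff.2 fun h0 => hx.2 ?_⟩
    simp [h0]
  have hsum := Finset.sum_le_sum fun i (_ : i ∈ Finset.univ) => hi i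
  rw [← Finset.sum_mul] at hsum
  unfold bernoulliEnergy
  simp_rw [integral_norm_weakGradient_linearMap_sq]
  rw [← Finset.sum_mul]
  have h3 := mul_nonneg (sub_nonneg.2 hA) (sub_nonneg.2 hmb)
  have h4 := mul_le_mul_of_nonneg_left hu hΛ.le
  linarith

/-! ### Opening a slab along the nodal hyperplane -/

/-- Integrating a bump function gives a bounded smooth profile that is the identity on `[-1, 1]`
and whose slope is at most one and vanishes outside `(-ρ, ρ)`. -/
theorem exists_profile {ρ : ℝ} (hρ : 1 < ρ) : ∃ (α c : ℝ → ℝ) (M : ℝ), ContDiff ℝ (⊤ : ℕ∞) α ∧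
    (∀ t, HasDerivAt α (c t) t) ∧ (∀ t, |t| ≤ 1 → α t = t) ∧ (∀ t, |c t| ≤ 1) ∧
    (∀ t, ρ ≤ |t| → c t = 0) ∧ ∀ t, |α t| ≤ M := by
  let f : ContDiffBump (0 : ℝ) := ⟨1, ρ, one_pos, hρ⟩
  have hder : ∀ t, HasDerivAt (fun t => ∫ r in (0 : ℝ)..t, f r) (f t) t := fun t =>
    intervalIntegral.integral_hasDerivAt_right (f.continuous.intervalIntegrable _ _)
      (f.continuous.stronglyMeasurableAtFilter _ _) f.continuous.continuousAt
  refine ⟨fun t => ∫ r in (0 : ℝ)..t, f r, f, ∫ r, ‖f r‖, ?_, hder, fun t ht => ?_, fun t => ?_,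
    fun t ht => ?_, fun t => ?_⟩
  · refine contDiff_infty_iff_deriv.2 ⟨fun t => (hder t).differentiableAt, ?_⟩
    rw [show deriv (fun t => ∫ r in (0 : ℝ)..t, f r) = f from funext fun t => (hder t).deriv]
    exact f.contDiff
  · have h1 : ∀ r ∈ Set.uIcc 0 t, f r = 1 := fun r hr => by
      refine f.one_of_mem_closedBall ?_
      have h2 := Set.abs_sub_left_of_mem_uIcc hr
      rw [mem_closedBall_zero_iff, Real.norm_eq_abs]
      simp only [sub_zero] at h2
      exact h2.trans ht
    simp only
    rw [intervalIntegral.integral_congr h1]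
    simp
  · rw [abs_of_nonneg f.nonneg]; exact f.le_one
  · exact f.zero_of_le_dist (by simpa using ht)
  · rw [← Real.norm_eq_abs]
    refine intervalIntegral.norm_integral_le_integral_norm_uIoc.trans ?_
    have hi : Integrable (fun r => ‖f r‖) :=
      (f.continuous.integrable_of_hasCompactSupport f.hasCompactSupport).norm
    exact setIntegral_le_integral hi (.of_forall fun r => norm_nonneg _)

/-- The open box `{x : |⟪b i, x⟫| < w i for all i}` in the coordinates of an orthonormal basis. -/
def box {d : ℕ} (b : OrthonormalBasis (Fin d) ℝ (𝔼 d)) (w : Fin d → ℝ) : Set (𝔼 d) :=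
  {x | ∀ i, |inner ℝ (b i) x| < w i}

theorem box_eq_preimage {d : ℕ} (b : OrthonormalBasis (Fin d) ℝ (𝔼 d)) (w : Fin d → ℝ) :
    box b w = (fun x => (b.repr x).ofLp) ⁻¹' Set.univ.pi fun i => Set.Ioo (-w i) (w i) := by
  ext x
  simp [box, abs_lt, b.repr_apply_apply]

theorem measurableSet_box {d : ℕ} (b : OrthonormalBasis (Fin d) ℝ (𝔼 d)) (w : Fin d → ℝ) :
    MeasurableSet (box b w) := by
  rw [box_eq_preimage]
  exact ((PiLp.volume_preserving_ofLp (Fin d)).comp b.measurePreserving_repr).measurable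
    (MeasurableSet.univ_pi fun i => measurableSet_Ioo)

theorem volume_box {d : ℕ} (b : OrthonormalBasis (Fin d) ℝ (𝔼 d)) (w : Fin d → ℝ) :
    volume (box b w) = volume (Set.univ.pi fun i => Set.Ioo (-w i) (w i)) := by
  rw [box_eq_preimage]
  exact ((PiLp.volume_preserving_ofLp (Fin d)).comp b.measurePreserving_repr).measure_preimage
    (MeasurableSet.univ_pi fun i => measurableSet_Ioo).nullMeasurableSet

theorem volume_box_ne_top {d : ℕ} (b : OrthonormalBasis (Fin d) ℝ (𝔼 d)) (w : Fin d → ℝ) :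
    volume (box b w) ≠ ⊤ := by
  rw [volume_box, Real.volume_pi_Ioo]
  exact ENNReal.prod_ne_top fun i _ => ENNReal.ofReal_ne_top

theorem volume_real_box {d : ℕ} (b : OrthonormalBasis (Fin d) ℝ (𝔼 d)) {w : Fin d → ℝ}
    (hw : ∀ i, 0 ≤ w i) : volume.real (box b w) = ∏ i, 2 * w i := by
  rw [measureReal_def, volume_box, Real.volume_pi_Ioo_toReal fun i => by linarith [hw i]]
  exact Finset.prod_congr rfl fun i _ => by ring

theorem volume_real_box_smul {d : ℕ} (b : OrthonormalBasis (Fin d) ℝ (𝔼 d)) {w : Fin d → ℝ}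
    (hw : ∀ i, 0 ≤ w i) {ρ : ℝ} (hρ : 0 ≤ ρ) :
    volume.real (box b fun i => ρ * w i) = ρ ^ d * volume.real (box b w) := by
  rw [volume_real_box b hw, volume_real_box b fun i => mul_nonneg hρ (hw i)]
  simp_rw [mul_left_comm 2 ρ, Finset.prod_mul_distrib]
  simp

/-- A smooth cutoff function between two concentric cubes, a product of one-dimensional ones. -/
theorem exists_cutoff {d : ℕ} (b : OrthonormalBasis (Fin d) ℝ (𝔼 d)) {ρ : ℝ} (hρ : 1 < ρ) :
    ∃ s : ℝ, 0 < s ∧ ∃ χ : 𝓓(unitBall d, ℝ), (∀ x, |χ x| ≤ 1) ∧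
      (∀ x ∈ box b fun _ => s, x ∈ unitBall d ∧ χ x = 1) ∧
      ∀ x, x ∉ (box b fun _ => ρ * s) → χ x = 0 := by
  have hd : (0 : ℝ) < d + 1 := by positivity
  have hρ0 : 0 < ρ := one_pos.trans hρ
  set s : ℝ := (ρ * (d + 1))⁻¹
  have hs : 0 < s := by positivity
  have hρs : ρ * s * (d + 1) = 1 := by simp only [s]; field_simp
  -- The cube of half-width `ρ s = 1 / (d + 1)` lies in the unit ball.
  have hball : ∀ x : 𝔼 d, (∀ i, |inner ℝ (b i) x| ≤ ρ * s) → x ∈ unitBall d := by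
    intro x hx
    change x ∈ Metric.ball 0 1
    have h1 : ‖x‖ ^ 2 ≤ d * (ρ * s) ^ 2 := by
      rw [← b.sum_sq_norm_inner_right x]
      refine (Finset.sum_le_card_nsmul _ _ ((ρ * s) ^ 2) fun i _ => ?_).trans (by simp)
      exact pow_le_pow_left₀ (norm_nonneg _) (hx i) 2
    have h2 : d * (ρ * s) ^ 2 < 1 := by
      have h3 : (1 : ℝ) = (ρ * s * (d + 1)) ^ 2 := by rw [hρs]; norm_num
      rw [h3]
      have : 0 < (ρ * s) ^ 2 := by positivity
      have hd0 : (0 : ℝ) ≤ d := Nat.cast_nonneg d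
      nlinarith
    rw [mem_ball_zero_iff]
    exact (sq_lt_one_iff₀ (norm_nonneg _)).1 (h1.trans_lt h2)
  let f : ContDiffBump (0 : ℝ) := ⟨s, ρ * s, hs, by nlinarith⟩
  have hC : ContDiff ℝ (⊤ : ℕ∞) (fun x : 𝔼 d => ∏ i, f (inner ℝ (b i) x)) :=
    contDiff_prod fun i _ =>
      f.contDiff.comp ((innerSL ℝ (b i)).contDiff (n := (⊤ : ℕ∞)))
  have hsupp : tsupport (fun x : 𝔼 d => ∏ i, f (inner ℝ (b i) x)) ⊆
      {x | ∀ i, |inner ℝ (b i) x| ≤ ρ * s} := by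
    refine closure_minimal (fun x hx i => ?_) ?_
    · by_contra! h
      exact hx (Finset.prod_eq_zero (Finset.mem_univ i)
        (f.zero_of_le_dist (by simpa using h.le)))
    · simp only [Set.ofPred_forall]
      exact isClosed_iInter fun i => isClosed_le
        (contDiff_inner_left (b i)).continuous.abs continuous_const
  have hsuppB := hsupp.trans hball
  have hcs : HasCompactSupport (fun x : 𝔼 d => ∏ i, f (inner ℝ (b i) x)) :=
    (isCompact_closedBall (0 : 𝔼 d) 1).of_isClosed_subset (isClosed_tsupport _)
      (hsuppB.trans Metric.ball_subset_closedBall)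
  refine ⟨s, hs, ⟨_, hC, hcs, hsuppB⟩, fun x => ?_, fun x hx => ⟨hball x fun i => ?_, ?_⟩,
    fun x hx => ?_⟩
  · change |∏ i, f (inner ℝ (b i) x)| ≤ 1
    rw [abs_of_nonneg (Finset.prod_nonneg fun i _ => f.nonneg)]
    exact Finset.prod_le_one (fun i _ => f.nonneg) fun i _ => f.le_one
  · exact (hx i).le.trans (le_mul_of_one_le_left hs.le hρ.le)
  · change ∏ i, f (inner ℝ (b i) x) = 1
    exact Finset.prod_eq_one fun i _ => f.one_of_mem_closedBall (by simpa [f] using (hx i).le)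
  · obtain ⟨i, hi⟩ := not_forall.1 hx
    exact Finset.prod_eq_zero (Finset.mem_univ i)
      (f.zero_of_le_dist (by simpa using not_lt.1 hi))

/-- For `δ → 0` the function `φ x = -δ α (⟪e, x⟫ / δ) χ x` cancels `⟪e, ·⟫` on a box of thickness
`2 δ`, while its gradient is `-α' χ e` up to an error of size `δ`, so that it has length at most
about one and is concentrated on a box larger by the factor `ρ`. -/
theorem exists_testFunction_gradient_lt {d : ℕ} {e : 𝔼 d} (he : ‖e‖ = 1) {a Λ : ℝ} (ha : 0 ≤ a)
    (haΛ : a < Λ) : ∃ φ : 𝓓(unitBall d, ℝ),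
      a * ∫ x in unitBall d, ‖∇ φ x‖ ^ 2 <
        Λ * volume.real {x | x ∈ unitBall d ∧ inner ℝ e x + φ x = 0} := by
  have hd : d ≠ 0 := by
    rintro rfl
    simp [Subsingleton.elim e 0] at he
  let i₀ : Fin d := ⟨0, Nat.pos_of_ne_zero hd⟩
  obtain ⟨b, hb⟩ := Orthonormal.exists_orthonormalBasis_extension_of_card_eq (𝕜 := ℝ) (E := 𝔼 d)
    (ι := Fin d) (by simp) (v := fun _ => e) (s := {i₀})
    ⟨fun _ => he, fun i j hij => (hij (Subsingleton.elim i j)).elim⟩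
  have hbe : b i₀ = e := hb i₀ rfl
  -- `ρ` absorbs the enlargement of the box and the cross term in `‖∇φ‖²`.
  obtain ⟨ρ, hρ, hρa⟩ : ∃ ρ : ℝ, 1 < ρ ∧ a * ρ ^ (d + 1) < Λ := by
    have h1 : Tendsto (fun ρ : ℝ => a * ρ ^ (d + 1)) (𝓝[>] 1) (𝓝 (a * 1 ^ (d + 1))) :=
      (Continuous.tendsto (by fun_prop) 1).mono_left nhdsWithin_le_nhds
    have h2 := h1.eventually_lt_const (by simpa using haΛ)
    exact (eventually_mem_nhdsWithin.and h2).exists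
  obtain ⟨α, c, M, hαC, hα, hα1, hc1, hc0, hM⟩ := exists_profile hρ
  obtain ⟨s, hs, χ, hχ1, hχs, hχ0⟩ := exists_cutoff b hρ
  have hχC : ContDiff ℝ 1 χ := χ.contDiff.of_le (by simp)
  obtain ⟨N, hN⟩ := (isCompact_closedBall (0 : 𝔼 d) 1).exists_bound_of_continuousOn
    (continuous_gradient hχC).continuousOn
  have hρ0 : 0 < ρ := one_pos.trans hρ
  have hM0 : 0 ≤ M := (abs_nonneg _).trans (hM 0)
  set κ : ℝ := (ρ - 1)⁻¹
  have hκ : (ρ - 1) * κ = 1 := mul_inv_cancel₀ (sub_ne_zero.2 hρ.ne')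
  have hκ0 : 0 < κ := inv_pos.2 (sub_pos.2 hρ)
  set K : ℝ := (1 + κ) * (M * N) ^ 2
  set β := volume.real (unitBall d : Set (𝔼 d))
  set P : ℝ := ∏ _i ∈ Finset.univ.erase i₀, 2 * s
  have hP : 0 < P := Finset.prod_pos fun _ _ => by positivity
  obtain ⟨δ, hδ0, hδs, hδ⟩ : ∃ δ : ℝ, 0 < δ ∧ δ < s ∧
      a * (K * β) * δ < (Λ - a * ρ ^ (d + 1)) * (2 * P) := by
    have h1 : Tendsto (fun δ : ℝ => a * (K * β) * δ) (𝓝[>] 0) (𝓝 (a * (K * β) * 0)) :=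
      (Continuous.tendsto (by fun_prop) 0).mono_left nhdsWithin_le_nhds
    have h2 := h1.eventually_lt_const (u := (Λ - a * ρ ^ (d + 1)) * (2 * P))
      (by rw [mul_zero]; exact mul_pos (sub_pos.2 hρa) (by positivity))
    have h3 : ∀ᶠ δ : ℝ in 𝓝[>] 0, δ < s := nhdsWithin_le_nhds (eventually_lt_nhds hs)
    exact (eventually_mem_nhdsWithin.and (h3.and h2)).exists
  set w : Fin d → ℝ := Function.update (fun _ => s) i₀ δ
  have hw0 : ∀ i, 0 ≤ w i := fun i => by
    rcases eq_or_ne i i₀ with rfl | hi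
    · simp [w, hδ0.le]
    · simp [w, hi, hs.le]
  have hws : ∀ i, w i ≤ s := fun i => by
    rcases eq_or_ne i i₀ with rfl | hi
    · simp [w, hδs.le]
    · simp [w, hi]
  have hvol : volume.real (box b w) = 2 * δ * P := by
    rw [volume_real_box b hw0, ← Finset.mul_prod_erase _ _ (Finset.mem_univ i₀)]
    refine congrArg₂ _ (by simp [w]) ?_
    exact Finset.prod_congr rfl fun i hi => by simp [w, Finset.ne_of_mem_erase hi]
  have hℓC : ContDiff ℝ (⊤ : ℕ∞) (fun x : 𝔼 d => inner ℝ e x) := (innerSL ℝ e).contDiff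
  have hφC : ContDiff ℝ (⊤ : ℕ∞)
      (fun x : 𝔼 d => -δ * α (δ⁻¹ * inner ℝ e x) * χ x) :=
    (contDiff_const.mul (hαC.comp (contDiff_const.mul hℓC))).mul χ.contDiff
  let φ : 𝓓(unitBall d, ℝ) := ⟨_, hφC, χ.hasCompactSupport.mul_left,
    (tsupport_mul_subset_right).trans χ.tsupport_subset⟩
  have hφ : ∀ x, φ x = -δ * α (δ⁻¹ * inner ℝ e x) * χ x := fun x => rfl
  have hgrad : ∀ x, ∇ φ x = -((c (δ⁻¹ * inner ℝ e x) * χ x) • e +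
      (δ * α (δ⁻¹ * inner ℝ e x)) • ∇ χ x) := by
    intro x
    have h1 : HasFDerivAt (fun x : 𝔼 d => inner ℝ e x) (innerSL ℝ e) x := (innerSL ℝ e).hasFDerivAt
    have h2 := (((hα _).comp_hasFDerivAt x (h1.const_mul δ⁻¹)).const_mul (-δ)).mul
      (hχC.differentiable one_ne_zero x).hasFDerivAt
    have h3 : HasFDerivAt φ _ x := h2
    refine ext_inner_right ℝ fun y => ?_
    rw [inner_gradient_left, h3.fderiv]
    simp [inner_add_left, real_inner_smul_left, inner_gradient_left]
    field_simp
  have hbox : ∀ x, x ∉ box b (fun i => ρ * w i) → c (δ⁻¹ * inner ℝ e x) * χ x = 0 := by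
    intro x hx
    obtain ⟨i, hi⟩ := not_forall.1 hx
    rw [not_lt] at hi
    rcases eq_or_ne i i₀ with rfl | hii
    · rw [hc0, zero_mul]
      rw [abs_mul, abs_inv, abs_of_pos hδ0, ← div_eq_inv_mul, le_div_iff₀ hδ0]
      simpa [w, hbe] using hi
    · rw [hχ0 x fun h => ?_, mul_zero]
      refine absurd (h i) (not_lt.2 ?_)
      simpa [w, hii] using hi
  have hbound : ∀ x ∈ unitBall d, ‖∇ φ x‖ ^ 2 ≤
      ρ * (box b fun i => ρ * w i).indicator 1 x + K * δ ^ 2 := by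
    intro x hx
    have hp : ‖(c (δ⁻¹ * inner ℝ e x) * χ x) • e‖ ^ 2 ≤
        (box b fun i => ρ * w i).indicator 1 x := by
      by_cases hxb : x ∈ box b fun i => ρ * w i
      · rw [Set.indicator_of_mem hxb, norm_smul, he, mul_one, norm_mul]
        exact pow_le_one₀ (by positivity) (mul_le_one₀ (hc1 _) (norm_nonneg _) (hχ1 _))
      · rw [Set.indicator_of_notMem hxb, hbox x hxb]; simp
    have hr : ‖(δ * α (δ⁻¹ * inner ℝ e x)) • ∇ χ x‖ ^ 2 ≤ (M * N) ^ 2 * δ ^ 2 := by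
      rw [← mul_pow]
      refine pow_le_pow_left₀ (norm_nonneg _) ?_ 2
      rw [norm_smul, norm_mul, Real.norm_of_nonneg hδ0.le]
      calc δ * ‖α (δ⁻¹ * inner ℝ e x)‖ * ‖∇ χ x‖ ≤ δ * M * N := by
            gcongr
            · exact hM _
            · exact hN x (Metric.ball_subset_closedBall hx)
        _ = M * N * δ := by ring
    rw [hgrad, norm_neg]
    set p := (c (δ⁻¹ * inner ℝ e x) * χ x) • e
    set r := (δ * α (δ⁻¹ * inner ℝ e x)) • ∇ χ x
    have hpr : ‖p + r‖ ^ 2 ≤ ρ * ‖p‖ ^ 2 + (1 + κ) * ‖r‖ ^ 2 := by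
      have h1 := pow_le_pow_left₀ (norm_nonneg _) (norm_add_le p r) 2
      have h2 := mul_nonneg (sub_pos.2 hρ).le (sq_nonneg (‖p‖ - κ * ‖r‖))
      have h3 : (ρ - 1) * (‖p‖ - κ * ‖r‖) ^ 2 =
          (ρ - 1) * ‖p‖ ^ 2 - 2 * ((ρ - 1) * κ) * (‖p‖ * ‖r‖) + ((ρ - 1) * κ) * κ * ‖r‖ ^ 2 := by
        ring
      rw [h3, hκ] at h2
      nlinarith
    have h4 := mul_le_mul_of_nonneg_left hp hρ0.le
    have h5 := mul_le_mul_of_nonneg_left hr (by positivity : 0 ≤ 1 + κ)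
    simp only [K]
    linarith
  have hφ1 : ContDiff ℝ 1 φ := φ.contDiff.of_le (by simp)
  have hboxm := measurableSet_box b fun i => ρ * w i
  have hupper : ∫ x in unitBall d, ‖∇ φ x‖ ^ 2 ≤ ρ ^ (d + 1) * (2 * δ * P) + K * β * δ ^ 2 := by
    have hi1 : Integrable ((box b fun i => ρ * w i).indicator (1 : 𝔼 d → ℝ))
        (volume.restrict (unitBall d : Set (𝔼 d))) := (integrable_const 1).indicator hboxm
    have hi2 : Integrable (fun x => ρ * (box b fun i => ρ * w i).indicator 1 x + K * δ ^ 2)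
        (volume.restrict (unitBall d : Set (𝔼 d))) :=
      (hi1.const_mul ρ).add (integrable_const (K * δ ^ 2))
    calc _ ≤ ∫ x in unitBall d, (ρ * (box b fun i => ρ * w i).indicator 1 x + K * δ ^ 2) :=
          setIntegral_mono_on
            ((memLp_two_restrict_unitBall ((continuous_gradient hφ1).norm.pow 2)).integrable
              one_le_two) hi2 measurableSet_unitBall hbound
      _ = ρ * volume.real ((box b fun i => ρ * w i) ∩ unitBall d) + K * δ ^ 2 * β := by
          rw [integral_add (hi1.const_mul ρ) (integrable_const _), integral_const_mul,
            integral_indicator_one hboxm, measureReal_restrict_apply hboxm]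
          simp [β, mul_comm]
      _ ≤ ρ * volume.real (box b fun i => ρ * w i) + K * δ ^ 2 * β := by
          gcongr
          · exact volume_box_ne_top _ _
          · exact Set.inter_subset_left
      _ = _ := by rw [volume_real_box_smul b hw0 hρ0.le, hvol]; ring
  have hlower : 2 * δ * P ≤ volume.real {x | x ∈ unitBall d ∧ inner ℝ e x + φ x = 0} := by
    rw [← hvol]
    refine measureReal_mono (fun x hx => ?_) (measure_ne_top_of_subset
      (fun x (hx : x ∈ unitBall d ∧ _) => hx.1) (measure_ball_lt_top (x := (0 : 𝔼 d)) (r := 1)).ne)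
    obtain ⟨hxB, hx1⟩ := hχs x fun i => (hx i).trans_le (hws i)
    refine ⟨hxB, ?_⟩
    have hxi := (hx i₀).le
    rw [hφ, hx1, hα1]
    · field_simp; ring
    · rw [abs_mul, abs_inv, abs_of_pos hδ0, ← div_eq_inv_mul, div_le_one₀ hδ0]
      simpa [w, hbe] using hxi
  have h1 := mul_le_mul_of_nonneg_left hupper ha
  have h2 := mul_le_mul_of_nonneg_left hlower (ha.trans haΛ.le)
  have h3 := mul_lt_mul_of_pos_right hδ hδ0
  exact ⟨φ, (h1.trans_lt (by linarith)).trans_le h2⟩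

theorem exists_eq_mul_of_rank_eq_one {d k : ℕ} {A : Matrix (Fin k) (Fin d) ℝ} (hA : A.rank = 1) :
    ∃ (p : Fin k → ℝ) (q : Fin d → ℝ), p ≠ 0 ∧ q ≠ 0 ∧ ∀ i j, A i j = p i * q j := by
  obtain ⟨v, hv, hv'⟩ := finrank_eq_one_iff'.1 hA
  choose c hc using fun j : Fin d => hv' ⟨A.mulVecLin (Pi.single j 1), LinearMap.mem_range_self _ _⟩
  have h : ∀ i j, A i j = v.1 i * c j := fun i j => by
    have := congrFun (congrArg Subtype.val (hc j)) i
    simp at this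
    rw [← this]; ring
  refine ⟨v.1, c, fun h0 => hv (Subtype.ext h0), fun h0 => ?_, h⟩
  have : A = 0 := by ext i j; simp [h i j, h0]
  simp [this] at hA

theorem le_sum_sq_of_isSolution_linearMap {d k : ℕ} {Λ : ℝ} {A : Matrix (Fin k) (Fin d) ℝ}
    (hrank : A.rank = 1) (hsol : IsSolution Λ (unitBall d) (linearMap A)) :
    Λ ≤ ∑ i, ∑ j, A i j ^ 2 := by
  by_contra! hlt
  obtain ⟨p, q, hp, hq, hpq⟩ := exists_eq_mul_of_rank_eq_one hrank
  set Q : 𝔼 d := WithLp.toLp 2 q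
  have hQ : Q ≠ 0 := fun h => hq (by simpa [Q] using h)
  set e : 𝔼 d := ‖Q‖⁻¹ • Q
  have he : ‖e‖ = 1 := norm_smul_inv_norm (𝕜 := ℝ) hQ
  set c : Fin k → ℝ := fun i => p i * ‖Q‖
  have hrow : ∀ i, (WithLp.toLp 2 (A i) : 𝔼 d) = c i • e := by
    intro i
    have : c i • e = p i • Q := by
      simp only [c, e, smul_smul, mul_assoc, mul_inv_cancel₀ (norm_ne_zero_iff.2 hQ), mul_one]
    rw [this]; ext j; simp [hpq, Q]
  have hu : ∀ i x, linearMap A x i = c i * inner ℝ e x := fun i x => by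
    rw [linearMap_apply, hrow, real_inner_smul_left]
  have hc2 : ∀ i, ∑ j, A i j ^ 2 = c i ^ 2 := fun i => by
    rw [← norm_row_sq, hrow, norm_smul, he, mul_one, Real.norm_eq_abs, sq_abs]
  set a := ∑ i, ∑ j, A i j ^ 2
  have ha : a = ∑ i, c i ^ 2 := Finset.sum_congr rfl fun i _ => hc2 i
  have ha0 : 0 ≤ a := ha ▸ Finset.sum_nonneg fun i _ => sq_nonneg _
  obtain ⟨φ, hφ⟩ := exists_testFunction_gradient_lt he ha0 hlt
  have hφ1 : ContDiff ℝ 1 φ := φ.contDiff.of_le (by simp)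
  have hgφ := continuous_gradient hφ1
  -- The competitor, a multiple of `⟪e, ·⟫ + φ` in every component.
  set V : 𝔼 d → EuclideanSpace ℝ (Fin k) := fun x =>
    WithLp.toLp 2 fun i => c i * (inner ℝ e x + φ x)
  have hVC : ∀ i, ContDiff ℝ 1 (fun x => V x i) := fun i =>
    contDiff_const.mul ((contDiff_inner_left e).add hφ1)
  have hVg : ∀ i, ∇ (fun x => V x i) = fun x => c i • (e + ∇ φ x) := by
    intro i
    funext x
    have h1 : HasFDerivAt (fun x : 𝔼 d => inner ℝ e x) (innerSL ℝ e) x := (innerSL ℝ e).hasFDerivAt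
    have h2 := (h1.add (hφ1.differentiable one_ne_zero x).hasFDerivAt).const_mul (c i)
    have h3 : HasFDerivAt (fun x => V x i) _ x := h2
    refine ext_inner_right ℝ fun y => ?_
    rw [inner_gradient_left, h3.fderiv]
    simp [inner_add_left, real_inner_smul_left, inner_gradient_left]
  have hVu : ∀ i, (fun x => V x i - linearMap A x i) = fun x => c i * φ x := fun i => by
    funext x; rw [hu]; change c i * _ - _ = _; ring
  have hV0 : ∀ i, MemH10 (unitBall d) (fun x => V x i - linearMap A x i) := by
    intro i
    rw [hVu]
    have hC : ContDiff ℝ 1 (fun x => c i * φ x) := contDiff_const.mul hφ1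
    refine ⟨memH1_unitBall_of_contDiff hC, fun _ => c i • φ, ?_, ?_⟩
    · refine tendsto_const_nhds.congr fun n => ?_
      simp
    · refine tendsto_const_nhds.congr fun n => ?_
      rw [← eLpNorm_zero (ε := 𝔼 d) (p := 2) (μ := volume.restrict (unitBall d : Set (𝔼 d)))]
      refine eLpNorm_congr_ae ?_
      filter_upwards [weakGradient_unitBall_of_contDiff hC] with x hx
      rw [hx]
      exact (sub_self _).symm
  have hle := hsol.2 V (fun i => memH1_unitBall_of_contDiff (hVC i)) hV0
  have hfin : volume (unitBall d : Set (𝔼 d)) ≠ ⊤ := measure_ball_lt_top.ne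
  set β := volume.real (unitBall d : Set (𝔼 d))
  have hint : ∀ {f : 𝔼 d → ℝ}, Continuous f →
      Integrable f (volume.restrict (unitBall d : Set (𝔼 d))) :=
    fun hf => (memLp_two_restrict_unitBall hf).integrable one_le_two
  have hE : ∀ i, ∫ x in unitBall d, ‖weakGradient (unitBall d) (fun y => V y i) x‖ ^ 2 =
      c i ^ 2 * (β + ∫ x in unitBall d, ‖∇ φ x‖ ^ 2) := by
    intro i
    have h1 : ∫ x in unitBall d, fderiv ℝ φ x e = 0 := by
      rw [setIntegral_eq_integral_of_forall_compl_eq_zero,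
        integral_fderiv_apply_eq_zero hφ1 φ.hasCompactSupport]
      intro x hx
      rw [fderiv_of_notMem_tsupport (𝕜 := ℝ) (fun h => hx (φ.tsupport_subset h))]
      simp
    have hcf : Continuous fun x => fderiv ℝ φ x e :=
      (hφ1.continuous_fderiv one_ne_zero).clm_apply continuous_const
    calc _ = ∫ x in unitBall d, c i ^ 2 * ((1 + 2 * fderiv ℝ φ x e) + ‖∇ φ x‖ ^ 2) := by
          refine integral_congr_ae ?_
          filter_upwards [weakGradient_unitBall_of_contDiff (hVC i)] with x hx
          rw [hx, hVg]
          simp only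
          rw [norm_smul, mul_pow, Real.norm_eq_abs, sq_abs, norm_add_sq_real, he, real_inner_comm,
            inner_gradient_left, one_pow]
      _ = _ := by
          rw [integral_const_mul, integral_add (hint (by fun_prop)) (hint (by fun_prop)),
            integral_add (hint (by fun_prop)) (hint (by fun_prop)), integral_const_mul, h1]
          simp [β]
  set Z : Set (𝔼 d) := {x | x ∈ unitBall d ∧ inner ℝ e x + φ x = 0}
  have hZm : MeasurableSet Z := measurableSet_unitBall.inter
    (((contDiff_inner_left e).continuous.add φ.continuous).measurable
      (measurableSet_singleton (0 : ℝ)))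
  have hVpos : volume.real (positivitySet (unitBall d) V) ≤ β - volume.real Z := by
    have hZs : Z ⊆ unitBall d := fun x hx => hx.1
    rw [← measureReal_sdiff hZs hZm]
    refine measureReal_mono (fun x hx => ⟨hx.1, fun hxZ => ?_⟩)
      (measure_ne_top_of_subset Set.sdiff_subset hfin)
    have : V x = 0 := by ext i; change c i * _ = 0; rw [hxZ.2, mul_zero]
    have h2 := hx.2
    simp [this] at h2
  obtain ⟨i₀, hi₀⟩ := Function.ne_iff.1 hp
  have hupos : volume.real (positivitySet (unitBall d) (linearMap A)) = β := by
    refine measureReal_congr ?_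
    have he0 : e ≠ 0 := norm_ne_zero_iff.1 (by rw [he]; exact one_ne_zero)
    have h5 : ∀ᵐ x : 𝔼 d, inner ℝ e x ≠ 0 := by
      rw [ae_iff]; simpa using volume_setOf_inner_eq_zero he0
    filter_upwards [h5] with x hx
    refine propext ⟨fun h => h.1, fun h => ⟨h, norm_pos_iff.2 fun h0 => ?_⟩⟩
    have h6 := hu i₀ x
    rw [h0] at h6
    exact mul_ne_zero (mul_ne_zero hi₀ (norm_ne_zero_iff.2 hQ)) hx h6.symm
  unfold bernoulliEnergy at hle
  simp_rw [integral_norm_weakGradient_linearMap_sq, hE] at hle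
  rw [← Finset.sum_mul, ← Finset.sum_mul, ← ha, hupos] at hle
  have h7 := mul_le_mul_of_nonneg_left hVpos (ha0.trans hlt.le)
  linarith

end VectorialBernoulli

theorem lemma2p3 {d k : ℕ} (Λ : ℝ) (hΛ : 0 < Λ) (A : Matrix (Fin k) (Fin d) ℝ) :
    (Λ ≤ ∑ i, ∑ j, A i j ^ 2 →
      VectorialBernoulli.IsSolution Λ (VectorialBernoulli.unitBall d)
        (VectorialBernoulli.linearMap A)) ∧
    (A.rank = 1 →
      VectorialBernoulli.IsSolution Λ (VectorialBernoulli.unitBall d)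
        (VectorialBernoulli.linearMap A) →
      Λ ≤ ∑ i, ∑ j, A i j ^ 2) := by
  exact ⟨VectorialBernoulli.isSolution_linearMap_of_le hΛ,
    VectorialBernoulli.le_sum_sq_of_isSolution_linearMap⟩
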